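/- For nonnegative integers $d,L,n$, a set $C\subseteq\{0,1\}^n$ is a $(d,L,n)$-code if for every $w\in C$ and every set $D$ of $d$ coordinates there are at most $L$ vectors of $C$ that agree with $w$ in all coordinates outside $D$. Let $L(d)$ be the smallest $L$ for which there is an $\varepsilon>0$ such that for every $n$ there is a $(d,L,n)$-code of cardinality at least $\varepsilon 2^n$. For $d\ge 2$ let $g(d)$ be the maximum of $$\sum_{i=1}^{k+1}\ \prod_{j\in\{1,\dots,k+1\}\setminus\{i\}} a_j$$ over all integers $k\ge 1$ and all integers $a_1,\dots,a_{k+1}\ge 0$ with $a_1+\dots+a_{k+1}=d$. Then: 1. $L(5)\ge 8$, $L(6)\ge 12$, $L(7)\ge 20$, $L(8)\ge 32$, $L(9)\ge 48$ and $L(10)\ge 80$. 2. $L(d)\ge g(d)$ for every integer $d\ge 2$. 3. $L(d)\ge d\cdot 3^{(d-6)/3}$ for every positive integer $d$ divisible by $3$. -/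

import Mathlib

/-- A set `C` of binary vectors of length `n` is a `(d, L, n)`-code (a `(d, L)`-list decodable
erasure code of length `n`): for every codeword `w` and every set `D` of `d` erased positions,
at most `L` codewords complete the remaining part of `w`, that is, agree with `w` off `D`. -/
def IsErasureCode (d L n : ℕ) (C : Finset (Fin n → Bool)) : Prop :=
  ∀ w ∈ C, ∀ D : Finset (Fin n), D.card = d →
    (C.filter fun w' => ∀ i, i ∉ D → w' i = w i).card ≤ L

/-- There is a positive `ε` such that for every `n` there is a `(d, L, n)`-code with at least
`ε * 2 ^ n` codewords. -/
def HasDenseCodes (d L : ℕ) : Prop :=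
  ∃ ε : ℝ, 0 < ε ∧ ∀ n : ℕ, ∃ C : Finset (Fin n → Bool),
    IsErasureCode d L n C ∧ ε * 2 ^ n ≤ (C.card : ℝ)

/-- The quantity `L(d)`: the smallest `L` for which there are `(d, L, n)`-codes of positive
density, uniformly in `n`. -/
noncomputable def minListSize (d : ℕ) : ℕ :=
  sInf {L : ℕ | HasDenseCodes d L}

/-- The minimum defining `L(d)` is attained (the set of all vectors is a `(d, 2 ^ d, n)`-code). -/
theorem isLeast_minListSize (d : ℕ) : IsLeast {L : ℕ | HasDenseCodes d L} (minListSize d) := by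
  refine ⟨Nat.sInf_mem ⟨2 ^ d, 1, one_pos, fun n => ⟨Finset.univ, ?_, by simp⟩⟩,
    fun L hL => Nat.sInf_le hL⟩
  intro w _ D hD
  have h : (Finset.univ.filter fun w' : Fin n → Bool => ∀ i, i ∉ D → w' i = w i).card
      ≤ (Finset.univ : Finset (D → Bool)).card := by
    refine Finset.card_le_card_of_injOn (fun w' i => w' i) (fun _ _ => Finset.mem_coe.2
      (Finset.mem_univ _)) ?_
    intro u hu v hv huv
    simp only [Finset.coe_filter, Set.mem_ofPred_eq, Finset.mem_univ, true_and] at hu hv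
    funext i
    by_cases hi : i ∈ D
    · exact congrFun huv ⟨i, hi⟩
    · rw [hu i hi, hv i hi]
  simpa [hD] using h

/-- The value `∑ i, ∏ j ≠ i, a j` attached to a sequence `a` of `m` nonnegative integers. -/
def partitionValue {m : ℕ} (a : Fin m → ℕ) : ℕ :=
  ∑ i, ∏ j ∈ Finset.univ.erase i, a j

/-- The values of all the partitions `d = a_1 + ⋯ + a_{k+1}` with `k ≥ 1` and integers
`a_i ≥ 0`. -/
def partitionValues (d : ℕ) : Set ℕ :=
  {v | ∃ k : ℕ, 1 ≤ k ∧ ∃ a : Fin (k + 1) → ℕ, ∑ i, a i = d ∧ partitionValue a = v}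

/-- The quantity `g(d)`: the maximum of the values of these partitions of `d`. -/
noncomputable def maxPartitionValue (d : ℕ) : ℕ :=
  sSup (partitionValues d)

/-- The maximum defining `g(d)` is attained. -/
theorem isGreatest_maxPartitionValue (d : ℕ) :
    IsGreatest (partitionValues d) (maxPartitionValue d) := by
  have hb : BddAbove (partitionValues d) := by
    refine ⟨(d + 1) * (d + 1) ^ d, ?_⟩
    rintro v ⟨k, -, a, ha, rfl⟩
    have hle : ∀ j, a j ≤ d := fun j => ha ▸ Finset.single_le_sum (fun _ _ => Nat.zero_le _)
      (Finset.mem_univ j)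
    by_cases hk : k ≤ d
    · have h1 : ∀ i ∈ (Finset.univ : Finset (Fin (k + 1))),
          ∏ j ∈ Finset.univ.erase i, a j ≤ (d + 1) ^ d := by
        intro i _
        calc ∏ j ∈ Finset.univ.erase i, a j ≤ ∏ _j ∈ Finset.univ.erase i, (d + 1) :=
              Finset.prod_le_prod' fun j _ => (hle j).trans (Nat.le_succ d)
          _ = (d + 1) ^ k := by simp [Finset.card_erase_of_mem]
          _ ≤ (d + 1) ^ d := Nat.pow_le_pow_right (Nat.succ_pos d) hk
      calc partitionValue a ≤ (Finset.univ : Finset (Fin (k + 1))).card • (d + 1) ^ d :=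
            Finset.sum_le_card_nsmul _ _ _ h1
        _ ≤ (d + 1) * (d + 1) ^ d := by
            rw [Finset.card_univ, Fintype.card_fin, smul_eq_mul]
            exact Nat.mul_le_mul_right _ (Nat.succ_le_succ hk)
    · have h0 : partitionValue a = 0 := by
        refine Finset.sum_eq_zero fun i _ => ?_
        by_contra hne
        have hpos : ∀ j ∈ Finset.univ.erase i, 1 ≤ a j := fun j hj =>
          Nat.one_le_iff_ne_zero.2 (Finset.prod_ne_zero_iff.1 hne j hj)
        have h2 : (Finset.univ.erase i).card • 1 ≤ ∑ j ∈ Finset.univ.erase i, a j :=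
          Finset.card_nsmul_le_sum _ _ _ hpos
        have h3 : ∑ j ∈ Finset.univ.erase i, a j ≤ ∑ j, a j :=
          Finset.sum_le_sum_of_subset (Finset.erase_subset _ _)
        rw [Finset.card_erase_of_mem (Finset.mem_univ i), Finset.card_univ, Fintype.card_fin,
          smul_eq_mul] at h2
        omega
      simp [h0]
  exact ⟨Nat.sSup_mem ⟨_, 1, le_rfl, ![d, 0], by simp, rfl⟩ hb, fun v hv => le_csSup hb hv⟩

/-! Let `C` have density `ε`. Complementing if necessary, at least half of all entries of its words
are zeros, so a proportion at least `ε / 2` of the pairs (position `u`, word `w`) have `w u = 1` and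
stay in `C` when `u` is switched off. By convexity, many `m`-tuples of distinct positions share such
a `w`. Switching off the whole tuple gives a base `S` such that adding all but one of the positions
lands in `C`; averaging fixes one `S` with a positive density of tuples (`exists_blowup_shell`).
Erdős's box theorem (`exists_box`) puts a box `A_1 × ⋯ × A_m` of such tuples over `S`. Erase `a_j`
positions of each `A_j`. For every `i`, adding to `S` one erased position from each `A_j` with `j ≠
i` gives a word of `C`. These `∑ i, ∏ j ≠ i, a_j` words are distinct and agree off the `d` erased
positions (`partitionValue_le_of_blowup`). -/

/-! ### Boxes in dense relations -/

open Classical in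
/-- The injective `t`-tuples in a finite set are counted by a falling factorial. -/
theorem descFactorial_le_card_injective {α : Type} [Fintype α] (t : ℕ) (s : Finset α) :
    s.card.descFactorial t ≤
      (Finset.univ.filter fun e : Fin t → α => Function.Injective e ∧ ∀ i, e i ∈ s).card := by
  have h : Fintype.card (Fin t ↪ s) = s.card.descFactorial t := by
    rw [Fintype.card_embedding_eq]; simp
  rw [← h, ← Finset.card_univ]
  refine Finset.card_le_card_of_injOn (fun e i => (e i : α)) ?_ ?_
  · intro e _
    simp only [Finset.coe_filter, Finset.mem_univ, true_and, Set.mem_ofPred_eq]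
    exact ⟨fun i j hij => e.injective (Subtype.ext hij), fun i => (e i).2⟩
  · intro e _ e' _ hee
    ext i
    exact congrFun hee i

open Classical in
/-- A relation of positive density between `α` and `Y` has a positive density of injective
`t`-tuples in `α` with a common neighbour in `Y`. -/
theorem card_injective_tuples_ge {δ : ℝ} (hδ : 0 < δ) (t : ℕ) {α Y : Type} [Fintype α]
    [Fintype Y] (R : α → Y → Prop) (hN : 2 * (t : ℝ) / δ ≤ Fintype.card α)
    (hR : δ * Fintype.card α * Fintype.card Y ≤
      ((Finset.univ.filter fun p : α × Y => R p.1 p.2).card : ℝ)) :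
    (δ / 2) ^ t * (Fintype.card α : ℝ) ^ t * Fintype.card Y ≤
      ((Finset.univ.filter fun p : (Fin t → α) × Y =>
        Function.Injective p.1 ∧ ∀ i, R (p.1 i) p.2).card : ℝ) := by
  set s : Y → Finset α := fun y => Finset.univ.filter fun u => R u y with hs
  have h1 : (Finset.univ.filter fun p : α × Y => R p.1 p.2).card = ∑ y, (s y).card := by
    rw [← Finset.card_sigma]
    refine Finset.card_bij' (fun p _ => ⟨p.2, p.1⟩) (fun p _ => (p.2, p.1)) ?_ ?_ ?_ ?_ <;>
      simp [hs]
  have h2 : (Finset.univ.filter fun p : (Fin t → α) × Y =>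
        Function.Injective p.1 ∧ ∀ i, R (p.1 i) p.2).card =
      ∑ y, (Finset.univ.filter fun e : Fin t → α =>
        Function.Injective e ∧ ∀ i, e i ∈ s y).card := by
    rw [← Finset.card_sigma]
    refine Finset.card_bij' (fun p _ => ⟨p.2, p.1⟩) (fun p _ => (p.2, p.1)) ?_ ?_ ?_ ?_ <;>
      simp [hs]
  -- Truncated subtraction keeps the bases nonnegative, as the power mean inequality requires.
  have h3 : ∑ y, (((s y).card - t : ℕ) : ℝ) ^ t ≤
      ((Finset.univ.filter fun p : (Fin t → α) × Y =>
        Function.Injective p.1 ∧ ∀ i, R (p.1 i) p.2).card : ℝ) := by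
    rw [h2]
    push_cast
    refine Finset.sum_le_sum fun y _ => ?_
    have h4 : ((s y).card - t) ^ t ≤ (s y).card.descFactorial t :=
      (Nat.pow_le_pow_left (by omega) t).trans (Nat.pow_sub_le_descFactorial _ t)
    exact_mod_cast h4.trans (descFactorial_le_card_injective t (s y))
  refine le_trans ?_ h3
  rcases isEmpty_or_nonempty Y with hY | hY
  · simp
  have hY0 : (0 : ℝ) < Fintype.card Y := by exact_mod_cast Fintype.card_pos
  -- `hN` gives `t ≤ δ |α| / 2`, so subtracting `t` costs at most half of the mean degree.
  have h5 : δ / 2 * Fintype.card α * Fintype.card Y ≤ ∑ y, (((s y).card - t : ℕ) : ℝ) := by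
    have h6 : ∑ y, (((s y).card : ℝ) - t) ≤ ∑ y, (((s y).card - t : ℕ) : ℝ) :=
      Finset.sum_le_sum fun y _ => by
        rw [sub_le_iff_le_add]; exact_mod_cast (by omega : (s y).card ≤ (s y).card - t + t)
    refine le_trans ?_ h6
    rw [Finset.sum_sub_distrib, ← Nat.cast_sum, ← h1]
    simp only [Finset.sum_const, Finset.card_univ, nsmul_eq_mul]
    rw [div_le_iff₀ hδ] at hN
    nlinarith
  have h7 := Real.pow_arith_mean_le_arith_mean_pow Finset.univ
    (fun _ : Y => (Fintype.card Y : ℝ)⁻¹) (fun y => (((s y).card - t : ℕ) : ℝ))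
    (fun _ _ => by positivity) (by simp [hY0.ne']) (fun _ _ => Nat.cast_nonneg _) t
  rw [← Finset.mul_sum, ← Finset.mul_sum] at h7
  have h8 : δ / 2 * Fintype.card α ≤
      (Fintype.card Y : ℝ)⁻¹ * ∑ y, (((s y).card - t : ℕ) : ℝ) := by
    rw [inv_mul_eq_div, le_div_iff₀ hY0]; exact h5
  have h9 := (pow_le_pow_left₀ (by positivity) h8 t).trans h7
  rw [inv_mul_eq_div, le_div_iff₀ hY0, mul_pow] at h9
  exact h9

open Classical in
/-- Averaging: a dense set of pairs has a dense fibre. -/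
theorem exists_dense_fibre {X Y : Type} [Fintype X] [Fintype Y] [Nonempty X] (P : X → Y → Prop)
    {c : ℝ} (h : c * Fintype.card X ≤ ((Finset.univ.filter fun p : X × Y => P p.1 p.2).card : ℝ)) :
    ∃ x, c ≤ ((Finset.univ.filter fun y => P x y).card : ℝ) := by
  have h1 : (Finset.univ.filter fun p : X × Y => P p.1 p.2).card =
      ∑ x, (Finset.univ.filter fun y => P x y).card := by
    rw [← Finset.card_sigma]
    refine Finset.card_bij' (fun p _ => ⟨p.1, p.2⟩) (fun p _ => (p.1, p.2)) ?_ ?_ ?_ ?_ <;> simp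
  rw [h1, Nat.cast_sum, mul_comm, ← nsmul_eq_mul] at h
  obtain ⟨x, -, hx⟩ := Finset.exists_le_of_sum_le (s := Finset.univ) (f := fun _ : X => c)
    (g := fun x => ((Finset.univ.filter fun y => P x y).card : ℝ)) Finset.univ_nonempty
    (by simpa using h)
  exact ⟨x, hx⟩

open Classical in
/-- Erdős's theorem: a dense `m`-ary relation on a large finite set contains a box with all sides
of size `t`. -/
theorem exists_box (m t : ℕ) {δ : ℝ} (hδ : 0 < δ) : ∃ N : ℕ, ∀ (α : Type) [Fintype α],
    N ≤ Fintype.card α → ∀ R : (Fin m → α) → Prop,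
      δ * (Fintype.card α : ℝ) ^ m ≤ ((Finset.univ.filter R).card : ℝ) →
      ∃ A : Fin m → Fin t → α, (∀ i, Function.Injective (A i)) ∧
        ∀ f : Fin m → Fin t, R fun i => A i (f i) := by
  induction m generalizing δ with
  | zero =>
    refine ⟨0, fun α _ _ R hR => ⟨fun i => i.elim0, fun i => i.elim0, fun f => ?_⟩⟩
    have h0 : 0 < (Finset.univ.filter R).card := by
      have : (0 : ℝ) < δ * (Fintype.card α : ℝ) ^ 0 := by simpa using hδ
      exact_mod_cast this.trans_le hR
    obtain ⟨x, hx⟩ := Finset.card_pos.1 h0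
    have := (Finset.mem_filter.1 hx).2
    convert this using 1
  | succ m ih =>
    obtain ⟨N, hN⟩ := ih (δ := (δ / 2) ^ t) (by positivity)
    refine ⟨max 1 (max N ⌈2 * (t : ℝ) / δ⌉₊), fun α _ hα R hR => ?_⟩
    simp only [max_le_iff] at hα
    have hne : Nonempty α := Fintype.card_pos_iff.1 hα.1
    have hcard : (Finset.univ.filter fun p : α × (Fin m → α) => R (Fin.cons p.1 p.2)).card =
        (Finset.univ.filter R).card := by
      refine Finset.card_bij' (fun p _ => (Fin.cons p.1 p.2 : Fin (m + 1) → α))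
        (fun x _ => (x 0, Fin.tail x)) ?_ ?_ ?_ ?_ <;> simp
    have h1 := card_injective_tuples_ge hδ t (fun u (y : Fin m → α) => R (Fin.cons u y))
      ((Nat.le_ceil _).trans (by exact_mod_cast hα.2.2)) (by
        rw [hcard]
        refine le_of_eq_of_le ?_ hR
        simp [pow_succ]; ring)
    obtain ⟨e, he⟩ := exists_dense_fibre (X := Fin t → α) (Y := Fin m → α)
      (fun e y => Function.Injective e ∧ ∀ i, R (Fin.cons (e i) y))
      (c := (δ / 2) ^ t * (Fintype.card α : ℝ) ^ m) (by
        refine le_of_eq_of_le ?_ (h1.trans_eq ?_)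
        · simp; ring
        · congr!)
    -- Injectivity of `e` is part of the fibre condition, so reading it off needs one element of the
    -- fibre.
    have hpos : 0 < (Finset.univ.filter fun y : Fin m → α =>
        Function.Injective e ∧ ∀ i, R (Fin.cons (e i) y)).card := by
      have hc : (0 : ℝ) < Fintype.card α := by exact_mod_cast hα.1
      have : 0 < (δ / 2) ^ t * (Fintype.card α : ℝ) ^ m := by positivity
      exact Nat.cast_pos.1 (this.trans_le (he.trans_eq (by congr!)))
    obtain ⟨y, hy⟩ := Finset.card_pos.1 hpos
    have hinj := (Finset.mem_filter.1 hy).2.1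
    obtain ⟨A, hA, hbox⟩ := hN α hα.2.1 _ he
    refine ⟨Fin.cons e A, fun i => ?_, fun f => ?_⟩
    · refine Fin.cases ?_ (fun j => ?_) i
      · simpa using hinj
      · simpa using hA j
    · convert (hbox (Fin.tail f)).2 (f 0) using 1
      funext i
      refine Fin.cases ?_ (fun j => ?_) i <;> simp [Fin.tail]

/-! ### Shells in dense codes -/

/-- The word obtained from `S` by switching on the positions `e j` with `j ≠ i`. -/
def raiseExcept {m n : ℕ} (S : Fin n → Bool) (e : Fin m → Fin n) (i : Fin m) : Fin n → Bool :=
  fun x => S x || decide (∃ j, j ≠ i ∧ e j = x)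

/-- The positions `e` are distinct zeros of `S`, and switching on all of them but one always gives
a word of `C`. -/
def IsShell {m n : ℕ} (C : Finset (Fin n → Bool)) (S : Fin n → Bool) (e : Fin m → Fin n) : Prop :=
  Function.Injective e ∧ (∀ i, S (e i) = false) ∧ ∀ i, raiseExcept S e i ∈ C

/-- Each zero of a word of `C` gives a pair of a position and a word such that switching off
this position in this word gives a word of `C`. -/
theorem sum_zeros_le_card {n : ℕ} (C : Finset (Fin n → Bool)) :
    ∑ c ∈ C, (Finset.univ.filter fun u => c u = false).card ≤
      (Finset.univ.filter fun p : Fin n × (Fin n → Bool) =>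
        p.2 p.1 = true ∧ Function.update p.2 p.1 false ∈ C).card := by
  rw [← Finset.card_sigma]
  refine Finset.card_le_card_of_injOn (fun p => (p.2, Function.update p.1 p.2 true)) ?_ ?_
  · rintro ⟨c, u⟩ h
    simp only [Finset.coe_sigma, Set.mem_sigma_iff, Finset.mem_coe, Finset.mem_filter,
      Finset.mem_univ, true_and] at h
    simp only [Finset.coe_filter, Finset.mem_univ, true_and, Set.mem_ofPred_eq,
      Function.update_self, Function.update_idem]
    rw [← h.2, Function.update_eq_self]
    exact h.1
  · rintro ⟨c, u⟩ h ⟨c', u'⟩ h' heq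
    simp only [Finset.coe_sigma, Set.mem_sigma_iff, Finset.mem_coe, Finset.mem_filter,
      Finset.mem_univ, true_and] at h h'
    simp only [Prod.mk.injEq] at heq
    obtain ⟨rfl, heq⟩ := heq
    have h2 := congrArg (fun w => Function.update w u false) heq
    simp only [Function.update_idem] at h2
    rw [← h.2] at h2
    rw [Function.update_eq_self, h.2, ← h'.2, Function.update_eq_self] at h2
    rw [h2]

open Classical in
/-- Switching off a tuple of positions turns the common neighbours of the tuple into the bases of
shells. -/
theorem card_tuples_le_card_shells {m n : ℕ} (C : Finset (Fin n → Bool)) :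
    (Finset.univ.filter fun p : (Fin m → Fin n) × (Fin n → Bool) =>
        Function.Injective p.1 ∧
          ∀ i, p.2 (p.1 i) = true ∧ Function.update p.2 (p.1 i) false ∈ C).card ≤
      (Finset.univ.filter fun p : (Fin n → Bool) × (Fin m → Fin n) => IsShell C p.1 p.2).card := by
  -- No information is lost: `w` is true at every position of `e`, so it is recovered from its base
  -- and `e`.
  refine Finset.card_le_card_of_injOn
    (fun p => (fun x => p.2 x && !decide (∃ i, p.1 i = x), p.1)) ?_ ?_
  · rintro ⟨e, w⟩ h
    simp only [Finset.coe_filter, Finset.mem_univ, true_and, Set.mem_ofPred_eq] at h ⊢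
    obtain ⟨he, hw⟩ := h
    refine ⟨he, fun i => by simp, fun i => ?_⟩
    convert (hw i).2 using 1
    funext x
    by_cases hx : ∃ j, e j = x
    · obtain ⟨j, rfl⟩ := hx
      by_cases hj : j = i
      · subst hj
        simp [raiseExcept, he.eq_iff]
      · have := (hw j).1
        simp [raiseExcept, he.eq_iff, hj, this]
    · have hxi : x ≠ e i := fun h => hx ⟨i, h.symm⟩
      have h3 : ¬ ∃ j, j ≠ i ∧ e j = x := fun ⟨j, _, h⟩ => hx ⟨j, h⟩
      simp [raiseExcept, hxi, hx, h3]
  · rintro ⟨e, w⟩ h ⟨e', w'⟩ h' heq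
    simp only [Finset.coe_filter, Finset.mem_univ, true_and, Set.mem_ofPred_eq] at h h'
    simp only [Prod.mk.injEq] at heq
    obtain ⟨heq, rfl⟩ := heq
    refine Prod.ext rfl (funext fun x => ?_)
    by_cases hx : ∃ j, e j = x
    · obtain ⟨j, rfl⟩ := hx
      exact (h.2 j).1.trans (h'.2 j).1.symm
    · simpa [hx] using congrFun heq x

open Classical in
/-- A dense set of words, at least half of whose entries are zeros, contains a blow-up of a
shell. -/
theorem exists_blowup_shell (m t : ℕ) {ε : ℝ} (hε : 0 < ε) : ∃ n : ℕ,
    ∀ C : Finset (Fin n → Bool), ε * 2 ^ n ≤ (C.card : ℝ) →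
      n * C.card ≤ 2 * ∑ c ∈ C, (Finset.univ.filter fun u => c u = false).card →
      ∃ (A : Fin m → Fin t → Fin n) (S : Fin n → Bool), (∀ i, Function.Injective (A i)) ∧
        ∀ f : Fin m → Fin t, IsShell C S fun i => A i (f i) := by
  -- One factor 1/2 comes from counting zeros, the other from requiring distinct positions.
  obtain ⟨N, hN⟩ := exists_box m t (δ := (ε / 2 / 2) ^ m) (by positivity)
  obtain ⟨n, hnN, hnm⟩ : ∃ n : ℕ, N ≤ n ∧ 2 * (m : ℝ) / (ε / 2) ≤ n :=
    ⟨max N ⌈2 * (m : ℝ) / (ε / 2)⌉₊, le_max_left _ _,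
      (Nat.le_ceil _).trans (by exact_mod_cast le_max_right N _)⟩
  refine ⟨n, fun C hC hz => ?_⟩
  have h1 := card_injective_tuples_ge (half_pos hε) m
    (fun u (w : Fin n → Bool) => w u = true ∧ Function.update w u false ∈ C)
    (by rwa [Fintype.card_fin]) (by
      have h2 := hz.trans (Nat.mul_le_mul_left 2 (sum_zeros_le_card C))
      have h3 : (n : ℝ) * C.card ≤ 2 * ((Finset.univ.filter fun p : Fin n × (Fin n → Bool) =>
        p.2 p.1 = true ∧ Function.update p.2 p.1 false ∈ C).card : ℝ) := by exact_mod_cast h2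
      have h4 := mul_le_mul_of_nonneg_left hC (Nat.cast_nonneg (α := ℝ) n)
      have h5 : (Fintype.card (Fin n → Bool) : ℝ) = 2 ^ n := by simp
      rw [h5, Fintype.card_fin]
      have h6 : ε / 2 * n * 2 ^ n ≤ ((Finset.univ.filter fun p : Fin n × (Fin n → Bool) =>
        p.2 p.1 = true ∧ Function.update p.2 p.1 false ∈ C).card : ℝ) := by nlinarith
      exact h6.trans_eq (by congr!))
  obtain ⟨S, hS⟩ := exists_dense_fibre (X := Fin n → Bool) (Y := Fin m → Fin n)
    (fun S e => IsShell C S e) (c := (ε / 2 / 2) ^ m * (n : ℝ) ^ m) (by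
      rw [Fintype.card_fin] at h1
      refine h1.trans (le_trans (le_of_eq ?_) (Nat.cast_le.2 (card_tuples_le_card_shells C)))
      congr!)
  obtain ⟨A, hA, h⟩ := hN (Fin n) (by simpa using hnN) (fun e => IsShell C S e) (by simpa using hS)
  exact ⟨A, S, hA, h⟩

/-- Complementing all words preserves erasure codes. -/
theorem IsErasureCode.image_not {d L n : ℕ} {C : Finset (Fin n → Bool)}
    (hC : IsErasureCode d L n C) :
    IsErasureCode d L n (C.image fun w i => !w i) := by
  intro w hw D hD
  obtain ⟨v, hv, rfl⟩ := Finset.mem_image.1 hw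
  refine le_trans ?_ (hC v hv D hD)
  refine Finset.card_le_card_of_injOn (fun w i => !w i) ?_ ?_
  · intro u hu
    simp only [Finset.coe_filter, Finset.mem_image, Set.mem_ofPred_eq] at hu ⊢
    obtain ⟨⟨x, hx, rfl⟩, h⟩ := hu
    simpa [hx] using h
  · intro u _ v _ huv
    funext i
    simpa using congrFun huv i

/-- Up to complementation, at least half of the entries of the words of a set are zeros. -/
theorem exists_zeros_ge {d L n : ℕ} {C : Finset (Fin n → Bool)} (hC : IsErasureCode d L n C) :
    ∃ C' : Finset (Fin n → Bool), IsErasureCode d L n C' ∧ C'.card = C.card ∧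
      n * C'.card ≤ 2 * ∑ c ∈ C', (Finset.univ.filter fun u => c u = false).card := by
  have hinj : Function.Injective fun (w : Fin n → Bool) i => !w i := fun u v huv => by
    funext i
    simpa using congrFun huv i
  have hsum : ∑ c ∈ C, (Finset.univ.filter fun u => c u = false).card +
      ∑ c ∈ C.image (fun w i => !w i), (Finset.univ.filter fun u => c u = false).card =
      n * C.card := by
    rw [Finset.sum_image hinj.injOn, ← Finset.sum_add_distrib, mul_comm, ← smul_eq_mul,
      ← Finset.sum_const]
    refine Finset.sum_congr rfl fun c _ => ?_
    have := Finset.card_filter_add_card_filter_not (s := (Finset.univ : Finset (Fin n)))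
      (fun u => c u = false)
    simpa using this
  have hcard := Finset.card_image_of_injective C hinj
  by_cases h : n * C.card ≤ 2 * ∑ c ∈ C, (Finset.univ.filter fun u => c u = false).card
  · exact ⟨C, hC, rfl, h⟩
  · exact ⟨_, hC.image_not, hcard, by rw [hcard]; omega⟩

/-! ### From blow-ups to list sizes -/

/-- A blow-up of a shell in an erasure code bounds the list size from below. -/
theorem partitionValue_le_of_blowup {d L n m t : ℕ} {C : Finset (Fin n → Bool)}
    (hC : IsErasureCode d L n C) (a : Fin m → ℕ) (ha : ∑ i, a i = d) (hat : ∀ i, a i < t)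
    (A : Fin m → Fin t → Fin n) (S : Fin n → Bool) (hA : ∀ i, Function.Injective (A i))
    (hS : ∀ f : Fin m → Fin t, IsShell C S fun i => A i (f i)) :
    partitionValue a ≤ L := by
  -- The sides are disjoint: a common point would be repeated in some tuple of the box, but shells
  -- are injective.
  have hAA : ∀ {i j b c}, A i b = A j c → i = j ∧ b = c := by
    intro i j b c h
    have hij : i = j := by
      by_contra hne
      refine hne ((hS fun k => if k = i then b else c).1 ?_)
      simpa [Ne.symm hne] using h
    subst hij
    exact ⟨rfl, hA i h⟩
  have hcardlt : ∀ j, (Finset.univ.filter fun b : Fin t => (b : ℕ) < a j).card = a j := by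
    intro j
    rw [Fin.card_filter_val_lt]
    exact min_eq_right (hat j).le
  set D : Finset (Fin n) := (Finset.univ.sigma fun j : Fin m =>
    Finset.univ.filter fun b : Fin t => (b : ℕ) < a j).image fun p => A p.1 p.2 with hD
  have hDcard : D.card = d := by
    rw [hD, Finset.card_image_of_injective, Finset.card_sigma, ← ha]
    · exact Finset.sum_congr rfl fun j _ => hcardlt j
    · rintro ⟨i, b⟩ ⟨j, c⟩ h
      obtain ⟨rfl, rfl⟩ := hAA h
      rfl
  rcases Nat.eq_zero_or_pos m with rfl | hm
  · simp [partitionValue]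
  have ht : 0 < t := (Nat.zero_le _).trans_lt (hat ⟨0, hm⟩)
  -- The omitted coordinate does not affect the word; pinning it to 0 makes the indexing injective.
  set I : Finset (Σ _ : Fin m, (Fin m → Fin t)) := Finset.univ.sigma fun i =>
    Fintype.piFinset fun j => if j = i then {⟨0, ht⟩} else
      Finset.univ.filter fun b : Fin t => (b : ℕ) < a j with hI
  have hIcard : I.card = partitionValue a := by
    rw [hI, Finset.card_sigma]
    refine Finset.sum_congr rfl fun i _ => ?_
    rw [Fintype.card_piFinset, ← Finset.mul_prod_erase _ _ (Finset.mem_univ i), if_pos rfl,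
      Finset.card_singleton, one_mul]
    exact Finset.prod_congr rfl fun j hj => by
      rw [if_neg (Finset.ne_of_mem_erase hj), hcardlt]
  have hI0 : ∀ p ∈ I, p.2 p.1 = ⟨0, ht⟩ := by
    intro p hp
    have := Fintype.mem_piFinset.1 (Finset.mem_sigma.1 hp).2 p.1
    simpa using this
  have hI1 : ∀ p ∈ I, ∀ j, j ≠ p.1 → (p.2 j : ℕ) < a j := by
    intro p hp j hj
    have := Fintype.mem_piFinset.1 (Finset.mem_sigma.1 hp).2 j
    simpa [hj] using this
  set W : (Σ _ : Fin m, (Fin m → Fin t)) → Fin n → Bool :=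
    fun p => raiseExcept S (fun i => A i (p.2 i)) p.1 with hW
  have hWoff : ∀ p ∈ I, ∀ x, x ∉ D → W p x = S x := by
    intro p hp x hx
    have h : ¬ ∃ j, j ≠ p.1 ∧ A j (p.2 j) = x := by
      rintro ⟨j, hj, rfl⟩
      refine hx (Finset.mem_image.2 ⟨⟨j, p.2 j⟩, ?_, rfl⟩)
      simpa using hI1 p hp j hj
    simp only [hW, raiseExcept, h, decide_false, Bool.or_false]
  have hstep : ∀ p q, W p = W q → ∀ j, j ≠ p.1 → j ≠ q.1 ∧ q.2 j = p.2 j := by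
    intro p q hpq j hj
    have h := congrFun hpq (A j (p.2 j))
    have hSj : S (A j (p.2 j)) = false := (hS p.2).2.1 j
    have h1 : ∃ j', j' ≠ p.1 ∧ A j' (p.2 j') = A j (p.2 j) := ⟨j, hj, rfl⟩
    simp only [hW, raiseExcept, hSj, h1, decide_true, Bool.false_or] at h
    obtain ⟨k, hk, hkj⟩ := of_decide_eq_true h.symm
    obtain ⟨rfl, h2⟩ := hAA hkj
    exact ⟨hk, h2⟩
  have hWinj : Set.InjOn W I := by
    intro p hp q hq hpq
    have h1 : p.1 = q.1 := by
      by_contra h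
      exact (hstep p q hpq q.1 (Ne.symm h)).1 rfl
    obtain ⟨i, f⟩ := p
    obtain ⟨j, g⟩ := q
    simp only at h1
    subst h1
    congr 1
    funext j
    by_cases hj : j = i
    · subst hj
      exact (hI0 _ hp).trans (hI0 _ hq).symm
    · exact (hstep _ _ hpq j hj).2.symm
  rw [← hIcard]
  rcases I.eq_empty_or_nonempty with hE | ⟨p, hp⟩
  · simp [hE]
  refine le_trans (Finset.card_le_card_of_injOn W (fun q hq => ?_) hWinj)
    (hC (W p) ((hS p.2).2.2 p.1) D hDcard)
  simp only [Finset.coe_filter, Set.mem_ofPred_eq]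
  exact ⟨(hS q.2).2.2 q.1, fun x hx => (hWoff q hq x hx).trans (hWoff p hp x hx).symm⟩

/-- Every value of a partition of `d` bounds `L(d)` from below. -/
theorem partitionValue_le_minListSize {d m : ℕ} (a : Fin m → ℕ) (ha : ∑ i, a i = d) :
    partitionValue a ≤ minListSize d := by
  obtain ⟨ε, hε, h⟩ := (isLeast_minListSize d).1
  obtain ⟨n, hn⟩ := exists_blowup_shell m (d + 1) hε
  obtain ⟨C, hC, hcard⟩ := h n
  obtain ⟨C', hC', hcard', hz⟩ := exists_zeros_ge hC
  obtain ⟨A, S, hA, hS⟩ := hn C' (by rwa [hcard']) hz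
  exact partitionValue_le_of_blowup hC' a ha (fun i => Nat.lt_succ_of_le (ha ▸
    Finset.single_le_sum (fun _ _ => Nat.zero_le _) (Finset.mem_univ i))) A S hA hS

theorem proposition1p2 :
    (8 ≤ minListSize 5 ∧ 12 ≤ minListSize 6 ∧ 20 ≤ minListSize 7 ∧
      32 ≤ minListSize 8 ∧ 48 ≤ minListSize 9 ∧ 80 ≤ minListSize 10) ∧
    (∀ d : ℕ, 2 ≤ d → maxPartitionValue d ≤ minListSize d) ∧
    (∀ d : ℕ, 1 ≤ d → 3 ∣ d →
      (d : ℝ) * (3 : ℝ) ^ (((d : ℝ) - 6) / 3) ≤ (minListSize d : ℝ)) := by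
  refine ⟨⟨?_, ?_, ?_, ?_, ?_, ?_⟩, ?_, ?_⟩
  -- All parts are 2, with a single 1 for odd `d`. `decide` checks the sum; the value is matched by
  -- unfolding.
  · exact partitionValue_le_minListSize ![2, 2, 1] (by decide)
  · exact partitionValue_le_minListSize ![2, 2, 2] (by decide)
  · exact partitionValue_le_minListSize ![2, 2, 2, 1] (by decide)
  · exact partitionValue_le_minListSize ![2, 2, 2, 2] (by decide)
  · exact partitionValue_le_minListSize ![2, 2, 2, 2, 1] (by decide)
  · exact partitionValue_le_minListSize ![2, 2, 2, 2, 2] (by decide)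
  · intro d _
    obtain ⟨k, -, a, ha, hv⟩ := (isGreatest_maxPartitionValue d).1
    rw [← hv]
    exact partitionValue_le_minListSize a ha
  · rintro d hd ⟨m, rfl⟩
    obtain ⟨m, rfl⟩ : ∃ k, m = k + 1 := ⟨m - 1, by omega⟩
    -- With `d / 3 = m + 1` parts equal to 3, the value is `(m + 1) * 3 ^ m = d * 3 ^ (m - 1)`.
    have h := partitionValue_le_minListSize (d := 3 * (m + 1)) (fun _ : Fin (m + 1) => 3)
      (by simp [mul_comm])
    have hv : partitionValue (fun _ : Fin (m + 1) => 3) = (m + 1) * 3 ^ m := by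
      simp [partitionValue, Finset.card_erase_of_mem]
    rw [hv] at h
    have h3 : (((3 * (m + 1) : ℕ) : ℝ) - 6) / 3 = (m : ℝ) - 1 := by push_cast; ring
    rw [h3, Real.rpow_sub (by norm_num), Real.rpow_natCast, Real.rpow_one]
    have h4 : (((m + 1) * 3 ^ m : ℕ) : ℝ) ≤ (minListSize (3 * (m + 1)) : ℝ) := by exact_mod_cast h
    refine le_of_eq_of_le ?_ h4
    push_cast
    ring
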